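/- Let $\alpha=(\alpha^{ij})$ be a smooth Poisson structure on $\mathbb R^d$. A Kontsevich graph of type $(n,2)$ has aerial vertices $1,\dots,n$ and ground vertices $\bar 1,\bar 2$; each aerial vertex $k$ is the source of exactly two ordered edges $e_k^1=(k,\gamma^1(k))$, $e_k^2=(k,\gamma^2(k))$, with $\gamma^i(k)\ne k$ and $\gamma^1(k)\neq\gamma^2(k)$, and there are no other edges. $G_{n,2}$ is the set of these graphs, $|\Gamma|:=n$, and $\Gamma$ is called connected (a tree) if its restriction to the aerial vertices is connected as an undirected graph (respectively is connected without cycles, a pair of opposite edges counting as a cycle). $T_{n,2}$ is the set of trees. If $e_\Gamma$ is the number of edges landing on ground vertices, the number of loops of a connected graph is $b_\Gamma=n-e_\Gamma+1$; $B^j$ is the set of connected graphs of type $(n,2)$, $n\ge 1$, with $j$ loops. Let $$B_\Gamma(f_1,f_2)=\sum_{I:E_\Gamma\to\{1,\dots,d\}}\Big[\prod_{k=1}^n\Big(\prod_{e=(*,k)}\partial_{I(e)}\Big)\alpha^{I(e_k^1)I(e_k^2)}\Big]\prod_{a=1}^2\Big(\prod_{e=(*,\bar a)}\partial_{I(e)}\Big)f_a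 ,$$ let $\hat B_\Gamma$ be its symbol, a polynomial in $(p_1,p_2)$ with $B_\Gamma(e^{p_1x},e^{p_2x})=\hat B_\Gamma(p_1,p_2,x)e^{(p_1+p_2)x}$, and let $$W_\Gamma=\frac1{(2\pi)^{2n}}\int \bigwedge_{k=1}^n d\psi_k^1\wedge d\psi_k^2$$ be the Kontsevich weight, the integral being over the configurations of $n$ distinct points $z_1,\dots,z_n$ of the upper half plane, where $\psi_k^i=\arg\frac{q-z_k}{q-\bar z_k}$ with $q$ the position of $\gamma^i(k)$ and $\bar1,\bar2$ are placed at $0,1$. Kontsevich's star product of $f,g\in C^\infty(\mathbb R^d)$ is the formal power series $$f*g=fg+\sum_{n\ge1}\frac{h^n}{n!}\sum_{\Gamma\in G_{n,2}}W_\Gamma B_\Gamma(f,g).$$ For $j\ge 0$ put $D^j(p_1,p_2,x)=\sum_{\Gamma\in B^j}\frac{W_\Gamma}{|\Gamma|!}\hat B_\Gamma(p_1,p_2,x)$, a formal power series in $(p_1,p_2)$, and $D=\sum_{j\ge 0}h^jD^j$. Lemma (Exponential formula). For every $x\in\mathbb R^d$, the series $D(hp_1,hp_2,x)$ is divisible by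 $h$, $\frac1hD(hp_1,hp_2,x)$ is a formal power series in $h$ without constant term whose coefficients are polynomials in $(p_1,p_2)$, and for all $f,g\in C^\infty(\mathbb R^d)$ $$f*g(x)=\exp\Big(\frac1hD(h\partial_{x'},h\partial_{x''},x)\Big)f(x')g(x'')\Big|_{x'=x''=x}$$ as formal power series in $h$. (The coefficients at $x$ are not differentiated.) Moreover, the graphs in $B^0$ are exactly the Kontsevich trees of type $(n,2)$, $D^0(hp_1,hp_2,x)$ is divisible by $h$, and the semi-classical part $\frac1hD^0(hp_1,hp_2,x)$ gives the generating function: $$x(p_1+p_2)+\frac1hD^0(hp_1,hp_2,x)=S_h(p_1,p_2,x):=x(p_1+p_2)+\sum_{n\ge1}\frac{h^n}{n!}\sum_{\Gamma\in T_{n,2}}W_\Gamma\hat B_\Gamma(p_1,p_2,x).$$ -/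

import Mathlib

open scoped ContDiff

namespace StarProduct

/-! ### Poisson structures and partial derivatives on `ℝ^d` -/

/-- The partial derivative `∂_i f`. -/
noncomputable def partialDeriv {d : ℕ} (i : Fin d) (f : (Fin d → ℝ) → ℝ) : (Fin d → ℝ) → ℝ :=
  fun x => fderiv ℝ f x (Pi.single i 1)

/-- The multi-index derivative `∂^β f = ∂_0^{β_0} ⋯ ∂_{d-1}^{β_{d-1}} f`. -/
noncomputable def multiDeriv {d : ℕ} (β : Fin d → ℕ) (f : (Fin d → ℝ) → ℝ) :
    (Fin d → ℝ) → ℝ :=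
  (List.finRange d).foldr (fun i F => (partialDeriv i)^[β i] F) f

/-- A (smooth) Poisson structure on `ℝ^d`, given by its components `α^{ij}`. -/
structure PoissonStructure (d : ℕ) where
  /-- the components `α^{ij}(x)` -/
  comp : Fin d → Fin d → (Fin d → ℝ) → ℝ
  smooth : ∀ i j, ContDiff ℝ ∞ (comp i j)
  antisymm : ∀ i j x, comp i j x = - comp j i x
  jacobi : ∀ i j k x, ∑ l,
    (comp i l x * partialDeriv l (comp j k) x + comp j l x * partialDeriv l (comp k i) x
      + comp k l x * partialDeriv l (comp i j) x) = 0

/-! ### Kontsevich graphs -/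

/-- Kontsevich graphs of type `(n, m)`: the aerial vertices are `Sum.inl k`, the ground vertices
are `Sum.inr a`, and `γ k i` is the endpoint of the `i`-th edge starting at the aerial vertex `k`.
There are no small loops and no double edges. -/
def KGraph (n m : ℕ) : Type :=
  {γ : Fin n → Fin 2 → Fin n ⊕ Fin m // (∀ k i, γ k i ≠ Sum.inl k) ∧ ∀ k, γ k 0 ≠ γ k 1}

namespace KGraph

instance (n m : ℕ) : Fintype (KGraph n m) := by
  unfold KGraph; infer_instance

variable {n m : ℕ}

/-- The endpoint of the edge `e = (k, i)`, the `i`-th edge starting at `k`. -/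
def target (Γ : KGraph n m) (e : Fin n × Fin 2) : Fin n ⊕ Fin m := Γ.1 e.1 e.2

/-- The undirected simple graph underlying the restriction of `Γ` to the aerial vertices. -/
def aerialGraph (Γ : KGraph n m) : SimpleGraph (Fin n) where
  Adj k l := k ≠ l ∧ ((∃ i, Γ.1 k i = Sum.inl l) ∨ ∃ i, Γ.1 l i = Sum.inl k)
  symm := ⟨fun _ _ h => ⟨h.1.symm, h.2.symm⟩⟩
  loopless := ⟨fun _ h => h.1 rfl⟩

/-- `Γ` is connected if its restriction to the aerial vertices is. -/
def IsConnected (Γ : KGraph n m) : Prop := Γ.aerialGraph.Connected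

/-- `Γ` is a tree if its restriction to the aerial vertices is connected and has no cycle; a pair
of opposite edges `k → l`, `l → k` counts as a cycle (of length two). -/
def IsTree (Γ : KGraph n m) : Prop :=
  Γ.aerialGraph.IsTree ∧
    ∀ k l, ¬ ((∃ i, Γ.1 k i = Sum.inl l) ∧ ∃ i, Γ.1 l i = Sum.inl k)

/-- The number `e_Γ` of edges landing at ground vertices. -/
def groundEdges (Γ : KGraph n m) : ℕ :=
  (Finset.univ.filter fun e : Fin n × Fin 2 => (Γ.target e).isRight).card

/-- The number of loops `b_Γ = n - e_Γ + 1`. -/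
def loops (Γ : KGraph n m) : ℤ := (n : ℤ) - Γ.groundEdges + 1

/-- For a labelling `I` of the edges by coordinates, the multi-index whose `i`-th entry is the
number of edges with endpoint `v` and label `i`. -/
def inIndex {d : ℕ} (Γ : KGraph n m) (I : Fin n × Fin 2 → Fin d) (v : Fin n ⊕ Fin m) :
    Fin d → ℕ :=
  fun i => (Finset.univ.filter fun e : Fin n × Fin 2 => Γ.target e = v ∧ I e = i).card

/-- The factor `∏_k (∏_{e = (*, k)} ∂_{I(e)}) α^{I(e_k^1) I(e_k^2)}` at the point `x`. -/
noncomputable def aerialCoeff {d : ℕ} (α : PoissonStructure d) (Γ : KGraph n m)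
    (I : Fin n × Fin 2 → Fin d) (x : Fin d → ℝ) : ℝ :=
  ∏ k, multiDeriv (Γ.inIndex I (Sum.inl k)) (α.comp (I (k, 0)) (I (k, 1))) x

/-- The multidifferential operator `B_Γ`. -/
noncomputable def B {d : ℕ} (α : PoissonStructure d) (Γ : KGraph n m)
    (f : Fin m → (Fin d → ℝ) → ℝ) : (Fin d → ℝ) → ℝ :=
  fun x => ∑ I : Fin n × Fin 2 → Fin d,
    Γ.aerialCoeff α I x * ∏ a, multiDeriv (Γ.inIndex I (Sum.inr a)) (f a) x

/-- The symbol `\hat B_Γ(p_1, …, p_m, x)` at the point `x`, as a polynomial in the variables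
`p^a_i = X (a, i)`. It is characterized by `B_exp` below. -/
noncomputable def symbol {d : ℕ} (α : PoissonStructure d) (Γ : KGraph n m) (x : Fin d → ℝ) :
    MvPolynomial (Fin m × Fin d) ℝ :=
  ∑ I : Fin n × Fin 2 → Fin d, MvPolynomial.C (Γ.aerialCoeff α I x) *
    ∏ a, ∏ i, MvPolynomial.X (a, i) ^ Γ.inIndex I (Sum.inr a) i

end KGraph

lemma partialDeriv_iterate_exp {d : ℕ} (p : Fin d → ℝ) (c : ℝ) (i : Fin d) (N : ℕ) :
    (partialDeriv i)^[N] (fun y => c * Real.exp (∑ j, p j * y j)) =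
      fun y => (p i ^ N * c) * Real.exp (∑ j, p j * y j) := by
  induction N with
  | zero => simp
  | succ N ih =>
    rw [Function.iterate_succ_apply', ih]
    funext y
    have h1 : HasFDerivAt (fun y : Fin d → ℝ => ∑ j, p j * y j)
        (∑ j, p j • (ContinuousLinearMap.proj j : (Fin d → ℝ) →L[ℝ] ℝ)) y := by
      apply HasFDerivAt.fun_sum
      intro j _
      exact (hasFDerivAt_apply j y).const_mul (p j)
    have h2 := (h1.exp).const_mul (p i ^ N * c)
    unfold partialDeriv
    rw [h2.fderiv]
    simp [Pi.single_apply]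
    ring

lemma multiDeriv_exp {d : ℕ} (p : Fin d → ℝ) (β : Fin d → ℕ) :
    multiDeriv β (fun y => Real.exp (∑ j, p j * y j)) =
      fun y => (∏ i, p i ^ β i) * Real.exp (∑ j, p j * y j) := by
  have key : ∀ L : List (Fin d),
      L.foldr (fun i F => (partialDeriv i)^[β i] F) (fun y => Real.exp (∑ j, p j * y j)) =
        fun y => (L.map fun i => p i ^ β i).prod * Real.exp (∑ j, p j * y j) := by
    intro L
    induction L with
    | nil => simp
    | cons i L ih =>
      rw [List.foldr_cons, ih, partialDeriv_iterate_exp]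
      simp
  unfold multiDeriv
  rw [key, ← List.ofFn_eq_map, List.prod_ofFn]

/-- `B_Γ(e^{p_1 x}, …, e^{p_m x}) = \hat B_Γ(p_1, …, p_m, x) e^{(p_1 + ⋯ + p_m) x}`. -/
theorem KGraph.B_exp {n m d : ℕ} (α : PoissonStructure d) (Γ : KGraph n m)
    (p : Fin m → Fin d → ℝ) (x : Fin d → ℝ) :
    Γ.B α (fun a y => Real.exp (∑ j, p a j * y j)) x =
      MvPolynomial.eval (fun q => p q.1 q.2) (Γ.symbol α x) *
        Real.exp (∑ j, (∑ a, p a j) * x j) := by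
  have h : ∑ j, (∑ a, p a j) * x j = ∑ a, ∑ j, p a j * x j := by
    rw [Finset.sum_comm]
    simp_rw [Finset.sum_mul]
  rw [h, Real.exp_sum]
  simp only [KGraph.B, KGraph.symbol, multiDeriv_exp, map_sum, map_mul, map_prod, map_pow,
    MvPolynomial.eval_C, MvPolynomial.eval_X, Finset.prod_mul_distrib]
  rw [Finset.sum_mul]
  simp only [mul_assoc]

/-- The symbol is homogeneous of degree `e_Γ` in `(p_1, …, p_m)`. -/
theorem KGraph.symbol_isHomogeneous {n m d : ℕ} (α : PoissonStructure d) (Γ : KGraph n m)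
    (x : Fin d → ℝ) : (Γ.symbol α x).IsHomogeneous Γ.groundEdges := by
  refine MvPolynomial.IsHomogeneous.sum _ _ _ fun I _ => ?_
  have hdeg : Γ.groundEdges = 0 + ∑ a, ∑ i, Γ.inIndex I (Sum.inr a) i := by
    rw [zero_add, ← Fintype.sum_prod_type' (f := fun a i => Γ.inIndex I (Sum.inr a) i)]
    unfold KGraph.groundEdges KGraph.inIndex
    rw [← Finset.card_biUnion]
    · congr 1
      ext e
      rcases he : Γ.target e with k | a
      · simp [he]
      · simp [he]
    · rintro ⟨a, i⟩ _ ⟨b, j⟩ _ hne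
      refine Finset.disjoint_left.2 fun e he he' => hne ?_
      simp only [Finset.mem_filter, Finset.mem_univ, true_and] at he he'
      have h1 := he.1.symm.trans he'.1
      have h2 := he.2.symm.trans he'.2
      simp_all
  rw [hdeg]
  refine (MvPolynomial.isHomogeneous_C _ _).mul ?_
  refine MvPolynomial.IsHomogeneous.prod _ _ _ fun a _ => ?_
  refine MvPolynomial.IsHomogeneous.prod _ _ _ fun i _ => ?_
  simpa using (MvPolynomial.isHomogeneous_X ℝ (a, i)).pow (Γ.inIndex I (Sum.inr a) i)

/-! ### Kontsevich weights -/

/-- `(q - p) / (q - \bar p)`, whose argument is the hyperbolic angle `φ^h(p, q)`. -/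
noncomputable def angleRatio (p q : ℂ) : ℂ := (q - p) / (q - (starRingEnd ℂ) p)

/-- The configurations of `n` distinct points of the upper half plane. -/
def configSpace (n : ℕ) : Set (Fin n → ℂ) :=
  {z | (∀ k, 0 < (z k).im) ∧ Function.Injective z}

namespace KGraph

variable {n : ℕ}

/-- The position of a vertex in the configuration `z`: the ground vertices are at `0` and `1`. -/
noncomputable def position (z : Fin n → ℂ) : Fin n ⊕ Fin 2 → ℂ
  | Sum.inl k => z k
  | Sum.inr a => ((a : ℕ) : ℂ)

/-- `(q - p) / (q - \bar p)` for the edge `e = (p, q)` in the configuration `z`. -/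
noncomputable def edgeRatio (Γ : KGraph n 2) (e : Fin n × Fin 2) (z : Fin n → ℂ) : ℂ :=
  angleRatio (z e.1) (position z (Γ.target e))

/-- The 1-form `dψ_e` at `z`, where `ψ_e = arg u` for `u` the ratio of the edge `e`. As the argument
is only defined up to multiples of `2π`, its differential is written `Im (du / u)`; this is the
differential of every branch, see `fderiv_arg_edgeRatio`. -/
noncomputable def angleForm (Γ : KGraph n 2) (e : Fin n × Fin 2) (z v : Fin n → ℂ) : ℝ :=
  (fderiv ℝ (Γ.edgeRatio e) z v / Γ.edgeRatio e z).im

/-- The real tangent vectors `∂/∂x_k` (for `s = 0`) and `∂/∂y_k` (for `s = 1`). -/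
noncomputable def coordVector (b : Fin n × Fin 2) : Fin n → ℂ :=
  Pi.single b.1 (if b.2 = 0 then 1 else Complex.I)

/-- The density of the top degree form `⋀_k (dψ_k^1 ∧ dψ_k^2)` with respect to
`dx_1 ∧ dy_1 ∧ ⋯ ∧ dx_n ∧ dy_n`. Rows and columns are indexed by the same set, so that the
determinant does not depend on how it is enumerated. -/
noncomputable def weightDensity (Γ : KGraph n 2) (z : Fin n → ℂ) : ℝ :=
  (Matrix.of fun e b : Fin n × Fin 2 => Γ.angleForm e z (coordVector b)).det

/-- The Kontsevich weight `W_Γ`. The boundary strata of the compactified configuration space have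
measure zero, so the integral is taken over its interior. -/
noncomputable def weight (Γ : KGraph n 2) : ℝ :=
  1 / (2 * Real.pi) ^ (2 * n) * ∫ z in configSpace n, Γ.weightDensity z

lemma differentiableAt_edgeRatio (Γ : KGraph n 2) (e : Fin n × Fin 2) {z : Fin n → ℂ}
    (hz : z ∈ configSpace n) : DifferentiableAt ℝ (Γ.edgeRatio e) z := by
  have hpos : DifferentiableAt ℝ (fun z => position z (Γ.target e)) z := by
    rcases Γ.target e with k | a
    · exact differentiableAt_apply (𝕜 := ℝ) k z
    · exact differentiableAt_const _
  have him : 0 ≤ (position z (Γ.target e)).im := by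
    rcases Γ.target e with k | a
    · exact (hz.1 k).le
    · simp [position]
  have hc : DifferentiableAt ℝ (fun z : Fin n → ℂ => (starRingEnd ℂ) (z e.1)) z :=
    Complex.conjCLE.differentiableAt.comp z (differentiableAt_apply (𝕜 := ℝ) e.1 z)
  have hne : position z (Γ.target e) - (starRingEnd ℂ) (z e.1) ≠ 0 := by
    intro h
    have h2 := congrArg Complex.im h
    have h3 := hz.1 e.1
    simp at h2
    linarith
  exact (hpos.fun_sub (differentiableAt_apply (𝕜 := ℝ) e.1 z)).fun_mul
      ((hpos.fun_sub hc).inv hne)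

/-- Off its branch cut, the angle function has differential `angleForm`. -/
theorem fderiv_arg_edgeRatio (Γ : KGraph n 2) (e : Fin n × Fin 2) {z : Fin n → ℂ}
    (hz : z ∈ configSpace n) (hs : Γ.edgeRatio e z ∈ Complex.slitPlane) (v : Fin n → ℂ) :
    fderiv ℝ (fun w => Complex.arg (Γ.edgeRatio e w)) z v = Γ.angleForm e z v := by
  have h1 : HasFDerivAt (fun w => Complex.log (Γ.edgeRatio e w)) _ z :=
    ((Complex.hasStrictFDerivAt_log_real hs).hasFDerivAt).comp z
      (Γ.differentiableAt_edgeRatio e hz).hasFDerivAt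
  have h2 := (Complex.imCLM.hasFDerivAt (x := Complex.log (Γ.edgeRatio e z))).comp z h1
  have h3 : (fun w => Complex.arg (Γ.edgeRatio e w)) =
      Complex.imCLM ∘ fun w => Complex.log (Γ.edgeRatio e w) := by
    funext w
    simp [Complex.log_im]
  rw [h3, h2.fderiv, angleForm]
  simp [div_eq_inv_mul]

end KGraph

/-! ### The star product, and the formal series built from connected graphs -/

/-- Kontsevich's star product
`f * g = f g + ∑_{n ≥ 1} (h^n / n!) ∑_{Γ ∈ G_{n,2}} W_Γ B_Γ(f, g)`, a power series in `h`. -/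
noncomputable def star {d : ℕ} (α : PoissonStructure d) (f g : (Fin d → ℝ) → ℝ) :
    PowerSeries ((Fin d → ℝ) → ℝ) :=
  PowerSeries.mk fun n =>
    if n = 0 then f * g
    else (1 / (n.factorial : ℝ)) • ∑ Γ : KGraph n 2, Γ.weight • Γ.B α ![f, g]

/-- The variables `(p_1, p_2)`, with `p^a_i = X (a, i)`. -/
abbrev PVar (d : ℕ) : Type := Fin 2 × Fin d

/-- `B^j`, the set of connected Kontsevich graphs of type `(n, 2)`, `n ≥ 1`, with `j` loops. -/
def loopGraphs (j : ℕ) : Set (Σ n : ℕ, KGraph n 2) :=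
  {Γ | 1 ≤ Γ.1 ∧ Γ.2.IsConnected ∧ Γ.2.loops = j}

/-- `D^j(p_1, p_2, x) = ∑_{Γ ∈ B^j} (W_Γ / |Γ|!) \hat B_Γ(p_1, p_2, x)`, a formal power series in
`(p_1, p_2)` at the point `x`. The sum is infinite but locally finite, see `finite_loopGraphs`. -/
noncomputable def loopSeries {d : ℕ} (α : PoissonStructure d) (x : Fin d → ℝ) (j : ℕ) :
    MvPowerSeries (PVar d) ℝ :=
  fun β => ∑ᶠ Γ ∈ loopGraphs j,
    Γ.2.weight / (Γ.1.factorial : ℝ) * MvPolynomial.coeff β (Γ.2.symbol α x)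

/-- Only finitely many graphs contribute to a given coefficient of `D^j`. -/
theorem finite_loopGraphs {d : ℕ} (α : PoissonStructure d) (x : Fin d → ℝ) (j : ℕ)
    (β : PVar d →₀ ℕ) :
    {Γ ∈ loopGraphs j | MvPolynomial.coeff β (Γ.2.symbol α x) ≠ 0}.Finite := by
  have hfin : (Set.range fun s : Σ n : Fin (β.degree + j + 1), KGraph n 2 =>
      (⟨s.1, s.2⟩ : Σ n : ℕ, KGraph n 2)).Finite := Set.finite_range _
  refine hfin.subset ?_
  rintro ⟨n, Γ⟩ ⟨⟨_, _, hl⟩, hc⟩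
  have hdeg : β.degree = Γ.groundEdges := by
    have := Γ.symbol_isHomogeneous α x hc
    rw [← this, Finsupp.degree_eq_weight_one]
    rfl
  have hn : n < β.degree + j + 1 := by
    simp only [KGraph.loops] at hl
    omega
  exact ⟨⟨⟨n, hn⟩, Γ⟩, rfl⟩

/-- `D(p_1, p_2, x) = ∑_j h^j D^j(p_1, p_2, x)`. -/
noncomputable def fullSeries {d : ℕ} (α : PoissonStructure d) (x : Fin d → ℝ) :
    PowerSeries (MvPowerSeries (PVar d) ℝ) :=
  PowerSeries.mk (loopSeries α x)

/-- The substitution `F(p_1, p_2) ↦ F(h p_1, h p_2)` for `F = ∑_j h^j F_j` a power series in `h` and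
`(p_1, p_2)`: the part of `F_j` of degree `k` in `(p_1, p_2)` contributes to `h^{j+k}`. The
coefficients of the result are polynomials. -/
noncomputable def hScale {d : ℕ} (F : PowerSeries (MvPowerSeries (PVar d) ℝ)) :
    PowerSeries (MvPolynomial (PVar d) ℝ) :=
  PowerSeries.mk fun N => ∑ jk ∈ Finset.HasAntidiagonal.antidiagonal N,
    MvPolynomial.homogeneousComponent jk.2
      (MvPowerSeries.truncTotal (jk.2 + 1) (PowerSeries.coeff jk.1 F))

/-- Division by `h`, of a power series in `h` that is divisible by `h`. -/
noncomputable def divByH {R : Type*} [Semiring R] (F : PowerSeries R) : PowerSeries R :=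
  PowerSeries.mk fun N => PowerSeries.coeff (N + 1) F

/-- `(1/h) D(h p_1, h p_2, x)`. -/
noncomputable def exponent {d : ℕ} (α : PoissonStructure d) (x : Fin d → ℝ) :
    PowerSeries (MvPolynomial (PVar d) ℝ) :=
  divByH (hScale (fullSeries α x))

/-- The semi-classical part `(1/h) D^0(h p_1, h p_2, x)`. -/
noncomputable def semiclassicalPart {d : ℕ} (α : PoissonStructure d) (x : Fin d → ℝ) :
    PowerSeries (MvPolynomial (PVar d) ℝ) :=
  divByH (hScale (PowerSeries.C (loopSeries α x 0)))

/-- The exponential of a power series in `h` without constant term. -/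
noncomputable def expSeries {d : ℕ} (E : PowerSeries (MvPolynomial (PVar d) ℝ)) :
    PowerSeries (MvPolynomial (PVar d) ℝ) :=
  PowerSeries.subst E (PowerSeries.exp ℝ)

/-- `Q(∂_{x'}, ∂_{x''}) f(x') g(x'') |_{x' = x'' = x}`: a monomial `p_1^β p_2^γ` acts by
`∂^β f(x) ∂^γ g(x)`. -/
noncomputable def applySymbol {d : ℕ} (Q : MvPolynomial (PVar d) ℝ) (f g : (Fin d → ℝ) → ℝ)
    (x : Fin d → ℝ) : ℝ :=
  ∑ β ∈ Q.support, MvPolynomial.coeff β Q *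
    (multiDeriv (fun i => β (0, i)) f x * multiDeriv (fun i => β (1, i)) g x)

/-- `applySymbol`, coefficientwise in `h`. -/
noncomputable def applySeries {d : ℕ} (Q : PowerSeries (MvPolynomial (PVar d) ℝ))
    (f g : (Fin d → ℝ) → ℝ) (x : Fin d → ℝ) : PowerSeries ℝ :=
  PowerSeries.mk fun N => applySymbol (PowerSeries.coeff N Q) f g x

/-- The trivial generating function `S_0 = x (p_1 + p_2)`. -/
noncomputable def trivialGeneratingFunction {d : ℕ} (x : Fin d → ℝ) :
    MvPolynomial (PVar d) ℝ :=
  ∑ i, MvPolynomial.C (x i) * (MvPolynomial.X (0, i) + MvPolynomial.X (1, i))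

open Classical in
/-- The generating function of the formal symplectic groupoid,
`S_h(p_1, p_2, x) = x (p_1 + p_2) + ∑_{n ≥ 1} (h^n / n!) ∑_{Γ ∈ T_{n,2}} W_Γ \hat B_Γ(p_1, p_2, x)`,
the sum being over Kontsevich trees. -/
noncomputable def generatingFunction {d : ℕ} (α : PoissonStructure d) (x : Fin d → ℝ) :
    PowerSeries (MvPolynomial (PVar d) ℝ) :=
  PowerSeries.mk fun n =>
    if n = 0 then trivialGeneratingFunction x
    else (1 / (n.factorial : ℝ)) •
      ∑ Γ : KGraph n 2 with Γ.IsTree, Γ.weight • Γ.symbol α x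

end StarProduct

namespace StarProduct

open MeasureTheory

namespace KGraph

/-! ### Disjoint unions of graphs, sharing the two ground vertices -/

variable {a b n : ℕ}

/-! Both the symbol and the weight are multiplicative under disjoint union over the shared ground
vertices (`symbol_glue`, `weight_glue`). The symbol is, because a derivative landing on an aerial
vertex comes from an edge of the same component, while the coefficients at `x` are mere constants.
The weight is, because the matrix of angle forms becomes block diagonal and the configuration space
is, up to a null set, a product.

Let `a_n` and `c_n` be the sums of weight times symbol over all, respectively connected, graphs with
`n` aerial vertices. Marking a vertex and splitting off its component gives `n a_n = ∑_k C(n,k) k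
c_k a_{n-k}` (`nsmul_graphSum`). For `A = ∑ a_n h^n/n!` and `E = ∑ c_n h^n/n!` this says `h A' = (h
E') A`, and with `A(0) = 1` it forces `A = exp E` (`eq_subst_exp`).

It remains to recognise `E` as `(1/h) D(h p_1, h p_2, x)`. The symbol is homogeneous of degree
`e_Γ`, so a connected graph with `b_Γ` loops contributes to `h^(b_Γ + e_Γ) = h^(n+1)`, and division
by `h` restores `h^n` (`exponent_eq`). Since `b_Γ` is the first Betti number of the aerial
multigraph, `b_Γ = 0` singles out the trees (`isTree_iff`). Letting symbols act on `f` and `g` is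
linear and turns `\hat B_Γ` into `B_Γ` (`applySymbol_symbol`). -/

/-- The disjoint union of two graphs, with the vertices relabelled by `σ`. -/
def glue (σ : Fin a ⊕ Fin b ≃ Fin n) (Γ₁ : KGraph a 2) (Γ₂ : KGraph b 2) : KGraph n 2 :=
  ⟨fun k i => Sum.elim (fun j => Sum.map (σ ∘ Sum.inl) id (Γ₁.1 j i))
      (fun j => Sum.map (σ ∘ Sum.inr) id (Γ₂.1 j i)) (σ.symm k), by
    have hl : Function.Injective (Sum.map (σ ∘ Sum.inl) id : Fin a ⊕ Fin 2 → Fin n ⊕ Fin 2) :=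
      (σ.injective.comp Sum.inl_injective).sumMap Function.injective_id
    have hr : Function.Injective (Sum.map (σ ∘ Sum.inr) id : Fin b ⊕ Fin 2 → Fin n ⊕ Fin 2) :=
      (σ.injective.comp Sum.inr_injective).sumMap Function.injective_id
    constructor
    · intro k i
      obtain ⟨k | k, rfl⟩ := σ.surjective k
      · simpa using fun h => Γ₁.2.1 k i (hl h)
      · simpa using fun h => Γ₂.2.1 k i (hr h)
    · intro k
      obtain ⟨k | k, rfl⟩ := σ.surjective k
      · simpa using fun h => Γ₁.2.2 k (hl h)
      · simpa using fun h => Γ₂.2.2 k (hr h)⟩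

lemma glue_inl (σ : Fin a ⊕ Fin b ≃ Fin n) (Γ₁ : KGraph a 2) (Γ₂ : KGraph b 2) (j : Fin a)
    (i : Fin 2) : (glue σ Γ₁ Γ₂).1 (σ (Sum.inl j)) i = Sum.map (σ ∘ Sum.inl) id (Γ₁.1 j i) := by
  simp [glue]

lemma glue_inr (σ : Fin a ⊕ Fin b ≃ Fin n) (Γ₁ : KGraph a 2) (Γ₂ : KGraph b 2) (j : Fin b)
    (i : Fin 2) : (glue σ Γ₁ Γ₂).1 (σ (Sum.inr j)) i = Sum.map (σ ∘ Sum.inr) id (Γ₂.1 j i) := by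
  simp [glue]

/-- The edges of a disjoint union. -/
def edgeEquiv (σ : Fin a ⊕ Fin b ≃ Fin n) :
    (Fin a × Fin 2) ⊕ (Fin b × Fin 2) ≃ Fin n × Fin 2 :=
  (Equiv.sumProdDistrib (Fin a) (Fin b) (Fin 2)).symm.trans (σ.prodCongr (Equiv.refl _))

@[simp] lemma edgeEquiv_inl (σ : Fin a ⊕ Fin b ≃ Fin n) (e : Fin a × Fin 2) :
    edgeEquiv σ (Sum.inl e) = (σ (Sum.inl e.1), e.2) := rfl

@[simp] lemma edgeEquiv_inr (σ : Fin a ⊕ Fin b ≃ Fin n) (e : Fin b × Fin 2) :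
    edgeEquiv σ (Sum.inr e) = (σ (Sum.inr e.1), e.2) := rfl

lemma sumMap_eq_inr {f : Fin a → Fin n} {t : Fin a ⊕ Fin 2} {c : Fin 2} :
    Sum.map f id t = Sum.inr c ↔ t = Sum.inr c := by
  cases t <;> simp

lemma sumMap_eq_inl {f : Fin a → Fin n} (hf : Function.Injective f) {t : Fin a ⊕ Fin 2}
    {k : Fin a} : Sum.map f id t = Sum.inl (f k) ↔ t = Sum.inl k := by
  cases t <;> simp [hf.eq_iff]

lemma sumMap_ne_inl {f : Fin a → Fin n} {t : Fin a ⊕ Fin 2} {k : Fin n}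
    (hk : k ∉ Set.range f) : Sum.map f id t ≠ Sum.inl k := by
  rcases t with j | c
  · simpa using fun h => hk ⟨j, h⟩
  · simp

/-! ### The symbol of a disjoint union -/

/-- The targets are left unsimplified, so that the cases of `v` on the ground, in the first block
and in the second block are all specialisations. -/
lemma inIndex_glue {d : ℕ} (σ : Fin a ⊕ Fin b ≃ Fin n) (Γ₁ : KGraph a 2) (Γ₂ : KGraph b 2)
    (I : Fin n × Fin 2 → Fin d) (v : Fin n ⊕ Fin 2) (i : Fin d) :
    (glue σ Γ₁ Γ₂).inIndex I v i =
      (Finset.univ.filter fun e : Fin a × Fin 2 =>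
        Sum.map (σ ∘ Sum.inl) id (Γ₁.target e) = v ∧ I (edgeEquiv σ (Sum.inl e)) = i).card +
      (Finset.univ.filter fun e : Fin b × Fin 2 =>
        Sum.map (σ ∘ Sum.inr) id (Γ₂.target e) = v ∧ I (edgeEquiv σ (Sum.inr e)) = i).card := by
  simp only [inIndex, Finset.card_filter]
  rw [← Equiv.sum_comp (edgeEquiv σ), Fintype.sum_sum_type]
  simp only [target, edgeEquiv_inl, edgeEquiv_inr, glue_inl, glue_inr]
  congr!

lemma inIndex_glue_ground {d : ℕ} (σ : Fin a ⊕ Fin b ≃ Fin n) (Γ₁ : KGraph a 2)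
    (Γ₂ : KGraph b 2) (I : Fin n × Fin 2 → Fin d) (c : Fin 2) (i : Fin d) :
    (glue σ Γ₁ Γ₂).inIndex I (Sum.inr c) i =
      Γ₁.inIndex (fun e => I (edgeEquiv σ (Sum.inl e))) (Sum.inr c) i +
        Γ₂.inIndex (fun e => I (edgeEquiv σ (Sum.inr e))) (Sum.inr c) i := by
  rw [inIndex_glue]
  simp only [inIndex, sumMap_eq_inr]

lemma inIndex_glue_inl {d : ℕ} (σ : Fin a ⊕ Fin b ≃ Fin n) (Γ₁ : KGraph a 2)
    (Γ₂ : KGraph b 2) (I : Fin n × Fin 2 → Fin d) (j : Fin a) :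
    (glue σ Γ₁ Γ₂).inIndex I (Sum.inl (σ (Sum.inl j))) =
      Γ₁.inIndex (fun e => I (edgeEquiv σ (Sum.inl e))) (Sum.inl j) := by
  have h₁ := fun t => sumMap_eq_inl (σ.injective.comp Sum.inl_injective) (t := t) (k := j)
  have h₂ := fun t => sumMap_ne_inl (f := σ ∘ Sum.inr) (t := t) (k := σ (Sum.inl j)) (by simp)
  simp only [Function.comp_apply] at h₁
  funext i
  rw [inIndex_glue]
  simp [inIndex, h₁, h₂]
  congr!

lemma inIndex_glue_inr {d : ℕ} (σ : Fin a ⊕ Fin b ≃ Fin n) (Γ₁ : KGraph a 2)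
    (Γ₂ : KGraph b 2) (I : Fin n × Fin 2 → Fin d) (j : Fin b) :
    (glue σ Γ₁ Γ₂).inIndex I (Sum.inl (σ (Sum.inr j))) =
      Γ₂.inIndex (fun e => I (edgeEquiv σ (Sum.inr e))) (Sum.inl j) := by
  have h₁ := fun t => sumMap_eq_inl (σ.injective.comp Sum.inr_injective) (t := t) (k := j)
  have h₂ := fun t => sumMap_ne_inl (f := σ ∘ Sum.inl) (t := t) (k := σ (Sum.inr j)) (by simp)
  simp only [Function.comp_apply] at h₁
  funext i
  rw [inIndex_glue]
  simp [inIndex, h₁, h₂]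
  congr!

lemma aerialCoeff_glue {d : ℕ} (α : PoissonStructure d) (σ : Fin a ⊕ Fin b ≃ Fin n)
    (Γ₁ : KGraph a 2) (Γ₂ : KGraph b 2) (I : Fin n × Fin 2 → Fin d) (x : Fin d → ℝ) :
    (glue σ Γ₁ Γ₂).aerialCoeff α I x =
      Γ₁.aerialCoeff α (fun e => I (edgeEquiv σ (Sum.inl e))) x *
        Γ₂.aerialCoeff α (fun e => I (edgeEquiv σ (Sum.inr e))) x := by
  unfold aerialCoeff
  rw [← Equiv.prod_comp σ, Fintype.prod_sum_type]
  simp only [inIndex_glue_inl, inIndex_glue_inr, edgeEquiv_inl, edgeEquiv_inr]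

/-- A labelling of the union is a pair of labellings. Aerial factors separate, and exponents add at
the shared ground vertices. -/
theorem symbol_glue {d : ℕ} (α : PoissonStructure d) (σ : Fin a ⊕ Fin b ≃ Fin n)
    (Γ₁ : KGraph a 2) (Γ₂ : KGraph b 2) (x : Fin d → ℝ) :
    (glue σ Γ₁ Γ₂).symbol α x = Γ₁.symbol α x * Γ₂.symbol α x := by
  unfold symbol
  rw [Finset.sum_mul_sum, ← Fintype.sum_prod_type']
  refine Fintype.sum_equiv (((edgeEquiv σ).symm.arrowCongr (Equiv.refl _)).trans
    (Equiv.sumArrowEquivProdArrow _ _ _)) _ _ fun I => ?_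
  simp only [aerialCoeff_glue, inIndex_glue_ground, pow_add, Finset.prod_mul_distrib, map_mul]
  exact mul_mul_mul_comm _ _ _ _

/-! ### The weight of a disjoint union -/

/-- Restriction of a configuration along a map of index sets. -/
noncomputable def restrictCLM (ι : Fin a → Fin n) : (Fin n → ℂ) →L[ℝ] (Fin a → ℂ) :=
  ContinuousLinearMap.pi fun j => ContinuousLinearMap.proj (ι j)

/-- Chain rule: the ratio of an edge factors through the coordinates of its own block. Only the
restricted configuration must be nondegenerate. -/
lemma angleForm_restrict {Γ : KGraph n 2} {Γ₁ : KGraph a 2} {ι : Fin a → Fin n}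
    (h : ∀ j i, Γ.1 (ι j) i = Sum.map ι id (Γ₁.1 j i)) (e : Fin a × Fin 2) {z : Fin n → ℂ}
    (hz : z ∘ ι ∈ configSpace a) (v : Fin n → ℂ) :
    Γ.angleForm (ι e.1, e.2) z v = Γ₁.angleForm e (z ∘ ι) (v ∘ ι) := by
  have hcomp : Γ.edgeRatio (ι e.1, e.2) = Γ₁.edgeRatio e ∘ restrictCLM ι := by
    funext w
    have hp : position w (Sum.map ι id (Γ₁.1 e.1 e.2)) = position (w ∘ ι) (Γ₁.1 e.1 e.2) := by
      rcases Γ₁.1 e.1 e.2 with k | c <;> rfl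
    simp only [edgeRatio, target, h, hp, Function.comp_apply]
    rfl
  have hd : HasFDerivAt (𝕜 := ℝ) (Γ.edgeRatio (ι e.1, e.2))
      ((fderiv ℝ (Γ₁.edgeRatio e) (z ∘ ι)).comp (restrictCLM ι)) z := by
    rw [hcomp]
    exact HasFDerivAt.comp z (Γ₁.differentiableAt_edgeRatio e hz).hasFDerivAt
      (restrictCLM ι).hasFDerivAt
  unfold angleForm
  rw [hd.fderiv, hcomp]
  rfl

lemma coordVector_comp {ι : Fin a → Fin n} (hι : Function.Injective ι) (e : Fin a × Fin 2) :
    coordVector (ι e.1, e.2) ∘ ι = coordVector e := by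
  funext j
  simp [coordVector, Pi.single_apply, hι.eq_iff]

lemma coordVector_comp_of_notMem {ι : Fin a → Fin n} (e : Fin n × Fin 2)
    (he : e.1 ∉ Set.range ι) : coordVector e ∘ ι = 0 := by
  funext j
  have : ι j ≠ e.1 := fun h => he ⟨j, h⟩
  simp [coordVector, this]

lemma angleForm_zero (Γ : KGraph n 2) (e : Fin n × Fin 2) (z : Fin n → ℂ) :
    Γ.angleForm e z 0 = 0 := by
  simp [angleForm]

/-- Coordinate vectors of one block restrict to zero on the other, so the matrix is block diagonal
after reindexing by `edgeEquiv`. -/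
lemma weightDensity_glue (σ : Fin a ⊕ Fin b ≃ Fin n) (Γ₁ : KGraph a 2) (Γ₂ : KGraph b 2)
    {z : Fin n → ℂ} (h₁ : z ∘ σ ∘ Sum.inl ∈ configSpace a)
    (h₂ : z ∘ σ ∘ Sum.inr ∈ configSpace b) :
    (glue σ Γ₁ Γ₂).weightDensity z =
      Γ₁.weightDensity (z ∘ σ ∘ Sum.inl) * Γ₂.weightDensity (z ∘ σ ∘ Sum.inr) := by
  have il : Function.Injective (σ ∘ Sum.inl) := σ.injective.comp Sum.inl_injective
  have ir : Function.Injective (σ ∘ Sum.inr) := σ.injective.comp Sum.inr_injective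
  have al := fun e v => angleForm_restrict (ι := σ ∘ Sum.inl) (Γ := glue σ Γ₁ Γ₂) (Γ₁ := Γ₁)
    (fun j i => glue_inl σ Γ₁ Γ₂ j i) e h₁ v
  have ar := fun e v => angleForm_restrict (ι := σ ∘ Sum.inr) (Γ := glue σ Γ₁ Γ₂) (Γ₁ := Γ₂)
    (fun j i => glue_inr σ Γ₁ Γ₂ j i) e h₂ v
  have cl := fun e => coordVector_comp il e
  have cr := fun e => coordVector_comp ir e
  have zl : ∀ e : Fin b × Fin 2,
      coordVector (σ (Sum.inr e.1), e.2) ∘ (σ ∘ Sum.inl) = (0 : Fin a → ℂ) := fun e =>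
    coordVector_comp_of_notMem _ (by simp)
  have zr : ∀ e : Fin a × Fin 2,
      coordVector (σ (Sum.inl e.1), e.2) ∘ (σ ∘ Sum.inr) = (0 : Fin b → ℂ) := fun e =>
    coordVector_comp_of_notMem _ (by simp)
  simp only [Function.comp_apply] at al ar cl cr
  unfold weightDensity
  rw [← Matrix.det_submatrix_equiv_self (edgeEquiv σ),
    ← Matrix.det_fromBlocks_zero₂₁ _ (0 : Matrix (Fin a × Fin 2) (Fin b × Fin 2) ℝ)]
  congr 1
  ext (e | e) (c | c)
  · simp [al, cl]
  · simp [al, zl, angleForm_zero]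
  · simp [ar, zr, angleForm_zero]
  · simp [ar, cr]

/-- Splitting a configuration into two. -/
noncomputable def splitEquiv (σ : Fin a ⊕ Fin b ≃ Fin n) : (Fin n → ℂ) ≃ᵐ (Fin a → ℂ) × (Fin b → ℂ) :=
  (MeasurableEquiv.piCongrLeft (fun _ => ℂ) σ).symm.trans
    (MeasurableEquiv.sumPiEquivProdPi fun _ => ℂ)

lemma splitEquiv_apply (σ : Fin a ⊕ Fin b ≃ Fin n) (z : Fin n → ℂ) :
    splitEquiv σ z = (z ∘ σ ∘ Sum.inl, z ∘ σ ∘ Sum.inr) := rfl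

lemma measurePreserving_splitEquiv (σ : Fin a ⊕ Fin b ≃ Fin n) :
    MeasurePreserving (splitEquiv σ) :=
  (volume_measurePreserving_piCongrLeft (fun _ => ℂ) σ).symm.trans
    (volume_measurePreserving_sumPiEquivProdPi fun _ => ℂ)

/-- Points of different blocks may collide although each block is injective; these collisions lie in
proper subspaces, which are null. -/
lemma ae_injective (n : ℕ) : ∀ᵐ z : Fin n → ℂ, Function.Injective z := by
  have h : ∀ k l : Fin n, k ≠ l → ∀ᵐ z : Fin n → ℂ, z k ≠ z l := by
    intro k l hkl
    let s : Submodule ℝ (Fin n → ℂ) :=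
      LinearMap.ker ((LinearMap.proj k : (Fin n → ℂ) →ₗ[ℝ] ℂ) - LinearMap.proj l)
    have hs : s ≠ ⊤ := by
      intro h
      have : (Pi.single k 1 : Fin n → ℂ) ∈ s := h ▸ Submodule.mem_top
      simp [s, hkl] at this
    refine measure_mono_null (fun z hz => ?_) (Measure.addHaar_submodule volume s hs)
    simpa [s, sub_eq_zero] using hz
  have h' : ∀ᵐ z : Fin n → ℂ, ∀ k l : Fin n, k ≠ l → z k ≠ z l :=
    ae_all_iff.2 fun k => ae_all_iff.2 fun l => by
      by_cases hkl : k = l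
      · simp [hkl]
      · simpa [hkl] using h k l hkl
  filter_upwards [h'] with z hz k l hkl
  by_contra hne
  exact hz k l hne hkl

lemma measurableSet_configSpace (n : ℕ) : MeasurableSet (configSpace n) := by
  have h : configSpace n = (⋂ k, {z | 0 < (z k).im}) ∩
      ⋂ k, ⋂ l, {z : Fin n → ℂ | z k = z l → k = l} := by
    ext z
    simp [configSpace, Function.Injective]
  rw [h]
  refine (MeasurableSet.iInter fun k => ?_).inter
    (MeasurableSet.iInter fun k => MeasurableSet.iInter fun l => ?_)
  · exact measurableSet_lt measurable_const (Complex.measurable_im.comp (measurable_pi_apply k))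
  · by_cases hkl : k = l
    · simp [hkl]
    · simp only [hkl, imp_false]
      exact (measurableSet_eq_fun (measurable_pi_apply k) (measurable_pi_apply l)).compl

theorem weight_glue (σ : Fin a ⊕ Fin b ≃ Fin n) (Γ₁ : KGraph a 2) (Γ₂ : KGraph b 2) :
    (glue σ Γ₁ Γ₂).weight = Γ₁.weight * Γ₂.weight := by
  have hn : n = a + b := by simpa using (Fintype.card_congr σ).symm
  have key : ∫ z in configSpace n, (glue σ Γ₁ Γ₂).weightDensity z =
      (∫ z in configSpace a, Γ₁.weightDensity z) * ∫ z in configSpace b, Γ₂.weightDensity z := by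
    -- Indicators move everything to the full spaces, where `integral_prod_mul` needs no
    -- integrability; convergence of the weights plays no role.
    rw [← integral_indicator (measurableSet_configSpace n),
      ← integral_indicator (measurableSet_configSpace a),
      ← integral_indicator (measurableSet_configSpace b), ← integral_prod_mul]
    rw [← Measure.volume_eq_prod, ← (measurePreserving_splitEquiv σ).integral_comp']
    refine integral_congr_ae ?_
    filter_upwards [ae_injective n] with z hz
    rw [splitEquiv_apply]
    have hmem : z ∈ configSpace n ↔
        z ∘ σ ∘ Sum.inl ∈ configSpace a ∧ z ∘ σ ∘ Sum.inr ∈ configSpace b := by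
      constructor
      · intro h
        exact ⟨⟨fun k => h.1 _, hz.comp (σ.injective.comp Sum.inl_injective)⟩,
          ⟨fun k => h.1 _, hz.comp (σ.injective.comp Sum.inr_injective)⟩⟩
      · rintro ⟨h₁, h₂⟩
        refine ⟨fun k => ?_, hz⟩
        obtain ⟨k | k, rfl⟩ := σ.surjective k
        · exact h₁.1 k
        · exact h₂.1 k
    by_cases h₁ : z ∘ σ ∘ Sum.inl ∈ configSpace a
    · by_cases h₂ : z ∘ σ ∘ Sum.inr ∈ configSpace b
      · rw [Set.indicator_of_mem (hmem.2 ⟨h₁, h₂⟩), weightDensity_glue σ Γ₁ Γ₂ h₁ h₂]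
        simp only [Set.indicator_of_mem h₁, Set.indicator_of_mem h₂]
      · rw [Set.indicator_of_notMem fun h => h₂ (hmem.1 h).2]
        simp only [Set.indicator_of_notMem h₂, mul_zero]
    · rw [Set.indicator_of_notMem fun h => h₁ (hmem.1 h).1]
      simp only [Set.indicator_of_notMem h₁, zero_mul]
  unfold weight
  rw [key, hn, mul_add, pow_add]
  ring

lemma weight_zero (Γ : KGraph 0 2) : Γ.weight = 1 := by
  have h : configSpace 0 = Set.univ := by
    ext z
    simp [configSpace, Function.injective_of_subsingleton]
  simp [weight, h, weightDensity, Measure.volume_pi_eq_dirac (default : Fin 0 → ℂ)]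

lemma symbol_zero {d : ℕ} (α : PoissonStructure d) (x : Fin d → ℝ) (Γ : KGraph 0 2) :
    Γ.symbol α x = 1 := by
  simp [symbol, aerialCoeff, inIndex]


/-! ### Connected components -/

lemma glue_adj_inl (σ : Fin a ⊕ Fin b ≃ Fin n) (Γ₁ : KGraph a 2) (Γ₂ : KGraph b 2) (j : Fin a)
    (y : Fin n) : (glue σ Γ₁ Γ₂).aerialGraph.Adj (σ (Sum.inl j)) y ↔
      ∃ j', y = σ (Sum.inl j') ∧ Γ₁.aerialGraph.Adj j j' := by
  have h₁ := fun t k => sumMap_eq_inl (σ.injective.comp Sum.inl_injective) (t := t) (k := k)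
  have h₂ := fun t k => sumMap_ne_inl (f := σ ∘ Sum.inr) (t := t) (k := σ (Sum.inl k)) (by simp)
  have h₃ := fun t k => sumMap_ne_inl (f := σ ∘ Sum.inl) (t := t) (k := σ (Sum.inr k)) (by simp)
  simp only [Function.comp_apply] at h₁
  obtain ⟨j' | j', rfl⟩ := σ.surjective y
  · simp [aerialGraph, glue_inl, h₁]
  · simp [aerialGraph, glue_inl, glue_inr, h₂, h₃]

/-- By `glue_adj_inl`, a path that starts in the first block never leaves it. -/
lemma glue_reachable_inl (σ : Fin a ⊕ Fin b ≃ Fin n) (Γ₁ : KGraph a 2) (Γ₂ : KGraph b 2)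
    (j : Fin a) (y : Fin n) : (glue σ Γ₁ Γ₂).aerialGraph.Reachable (σ (Sum.inl j)) y ↔
      ∃ j', y = σ (Sum.inl j') ∧ Γ₁.aerialGraph.Reachable j j' := by
  constructor
  · intro h
    rw [SimpleGraph.reachable_iff_reflTransGen] at h
    induction h with
    | refl => exact ⟨j, rfl, SimpleGraph.Reachable.refl _⟩
    | tail _ hadj ih =>
      obtain ⟨j', rfl, hj'⟩ := ih
      obtain ⟨j'', rfl, hj''⟩ := (glue_adj_inl ..).1 hadj
      exact ⟨j'', rfl, hj'.trans hj''.reachable⟩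
  · rintro ⟨j', rfl, hj'⟩
    let φ : Γ₁.aerialGraph →g (glue σ Γ₁ Γ₂).aerialGraph :=
      ⟨fun k => σ (Sum.inl k), fun {k l} h => (glue_adj_inl ..).2 ⟨l, rfl, h⟩⟩
    exact hj'.map φ

lemma glue_injective (σ : Fin a ⊕ Fin b ≃ Fin n) {Γ₁ Γ₁' : KGraph a 2} {Γ₂ Γ₂' : KGraph b 2}
    (h : glue σ Γ₁ Γ₂ = glue σ Γ₁' Γ₂') : Γ₁ = Γ₁' ∧ Γ₂ = Γ₂' := by
  constructor
  · refine Subtype.ext (funext fun k => funext fun i => ?_)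
    apply (σ.injective.comp Sum.inl_injective).sumMap Function.injective_id
    rw [← glue_inl, ← glue_inl, h]
  · refine Subtype.ext (funext fun k => funext fun i => ?_)
    apply (σ.injective.comp Sum.inr_injective).sumMap Function.injective_id
    rw [← glue_inr, ← glue_inr, h]

/-- A graph without aerial edges between two sets of vertices is a disjoint union. -/
lemma exists_glue (σ : Fin a ⊕ Fin b ≃ Fin n) (Γ : KGraph n 2)
    (h : ∀ j k, ¬ Γ.aerialGraph.Adj (σ (Sum.inl j)) (σ (Sum.inr k))) :
    ∃ Γ₁ Γ₂, Γ = glue σ Γ₁ Γ₂ := by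
  have h₁ : ∀ j i, ∃ t, Γ.1 (σ (Sum.inl j)) i = Sum.map (σ ∘ Sum.inl) id t := by
    intro j i
    rcases ht : Γ.1 (σ (Sum.inl j)) i with y | c
    · obtain ⟨k | k, rfl⟩ := σ.surjective y
      · exact ⟨Sum.inl k, rfl⟩
      · exact (h j k ⟨by simp, Or.inl ⟨i, ht⟩⟩).elim
    · exact ⟨Sum.inr c, rfl⟩
  have h₂ : ∀ j i, ∃ t, Γ.1 (σ (Sum.inr j)) i = Sum.map (σ ∘ Sum.inr) id t := by
    intro j i
    rcases ht : Γ.1 (σ (Sum.inr j)) i with y | c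
    · obtain ⟨k | k, rfl⟩ := σ.surjective y
      · exact (h k j ⟨by simp, Or.inr ⟨i, ht⟩⟩).elim
      · exact ⟨Sum.inl k, rfl⟩
    · exact ⟨Sum.inr c, rfl⟩
  choose γ₁ hγ₁ using h₁
  choose γ₂ hγ₂ using h₂
  let Γ₁ : KGraph a 2 := ⟨γ₁, fun k i hk => Γ.2.1 (σ (Sum.inl k)) i (by rw [hγ₁, hk]; rfl),
    fun k hk => Γ.2.2 (σ (Sum.inl k)) (by rw [hγ₁, hγ₁, hk])⟩
  let Γ₂ : KGraph b 2 := ⟨γ₂, fun k i hk => Γ.2.1 (σ (Sum.inr k)) i (by rw [hγ₂, hk]; rfl),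
    fun k hk => Γ.2.2 (σ (Sum.inr k)) (by rw [hγ₂, hγ₂, hk])⟩
  refine ⟨Γ₁, Γ₂, Subtype.ext (funext fun k => funext fun i => ?_)⟩
  obtain ⟨k | k, rfl⟩ := σ.surjective k
  · exact (hγ₁ k i).trans (glue_inl σ Γ₁ Γ₂ k i).symm
  · exact (hγ₂ k i).trans (glue_inr σ Γ₁ Γ₂ k i).symm

open Classical in
/-- The set of aerial vertices in the connected component of `v`. -/
noncomputable def component (Γ : KGraph n 2) (v : Fin n) : Finset (Fin n) :=
  Finset.univ.filter (Γ.aerialGraph.Reachable v)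

lemma mem_component {Γ : KGraph n 2} {v y : Fin n} :
    y ∈ Γ.component v ↔ Γ.aerialGraph.Reachable v y := by
  simp [component]

/-- No edge leaves a component, hence the splitting. `Γ₂` is unconstrained, which is why the sum
over graphs with a prescribed component factors. -/
lemma component_eq_iff (σ : Fin a ⊕ Fin b ≃ Fin n) (S : Finset (Fin n))
    (hS : ∀ y, y ∈ S ↔ ∃ j, y = σ (Sum.inl j)) (j : Fin a) (Γ : KGraph n 2) :
    Γ.component (σ (Sum.inl j)) = S ↔ ∃ Γ₁ Γ₂, Γ₁.IsConnected ∧ Γ = glue σ Γ₁ Γ₂ := by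
  constructor
  · intro hc
    have hreach : ∀ y, Γ.aerialGraph.Reachable (σ (Sum.inl j)) y ↔ ∃ k, y = σ (Sum.inl k) :=
      fun y => by rw [← mem_component, hc, hS]
    obtain ⟨Γ₁, Γ₂, rfl⟩ := exists_glue σ Γ fun k l hadj => by
      obtain ⟨l', hl'⟩ := (hreach _).1 (((hreach _).2 ⟨k, rfl⟩).trans hadj.reachable)
      simp at hl'
    have hj : ∀ k, Γ₁.aerialGraph.Reachable j k := fun k => by
      obtain ⟨k', hk', h⟩ := (glue_reachable_inl ..).1 ((hreach _).2 ⟨k, rfl⟩)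
      simp at hk'
      exact hk' ▸ h
    have : Nonempty (Fin a) := ⟨j⟩
    exact ⟨Γ₁, Γ₂, ⟨fun k l => (hj k).symm.trans (hj l)⟩, rfl⟩
  · rintro ⟨Γ₁, Γ₂, hΓ₁, rfl⟩
    ext y
    rw [mem_component, hS, glue_reachable_inl]
    exact ⟨fun ⟨k, hk, _⟩ => ⟨k, hk⟩, fun ⟨k, hk⟩ => ⟨k, hk, hΓ₁.preconnected j k⟩⟩

open Classical in
lemma sum_component_eq {M : Type*} [AddCommMonoid M] (f : KGraph n 2 → M)
    (σ : Fin a ⊕ Fin b ≃ Fin n) (S : Finset (Fin n))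
    (hS : ∀ y, y ∈ S ↔ ∃ j, y = σ (Sum.inl j)) {v : Fin n} (hv : v ∈ S) :
    ∑ Γ with Γ.component v = S, f Γ =
      ∑ Γ₁ : KGraph a 2 with Γ₁.IsConnected, ∑ Γ₂ : KGraph b 2, f (glue σ Γ₁ Γ₂) := by
  obtain ⟨j, rfl⟩ := (hS v).1 hv
  rw [← Finset.sum_product']
  symm
  refine Finset.sum_bij (fun p _ => glue σ p.1 p.2) ?_ ?_ ?_ ?_
  · intro p hp
    simp only [Finset.mem_product, Finset.mem_filter, Finset.mem_univ, true_and, and_true] at hp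
    simpa using (component_eq_iff σ S hS j _).2 ⟨p.1, p.2, hp, rfl⟩
  · intro p _ q _ h
    exact Prod.ext (glue_injective σ h).1 (glue_injective σ h).2
  · intro Γ hΓ
    obtain ⟨Γ₁, Γ₂, h, rfl⟩ := (component_eq_iff σ S hS j Γ).1 (by simpa using hΓ)
    exact ⟨(Γ₁, Γ₂), by simpa using h, rfl⟩
  · intro _ _
    rfl

end KGraph

/-! ### The recursion between all graphs and connected graphs -/

open KGraph

/-- The sum of the weighted symbols of all graphs of type `(n, 2)`. -/
noncomputable def graphSum {d : ℕ} (α : PoissonStructure d) (x : Fin d → ℝ) (n : ℕ) :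
    MvPolynomial (PVar d) ℝ :=
  ∑ Γ : KGraph n 2, Γ.weight • Γ.symbol α x

open Classical in
/-- The sum of the weighted symbols of the connected graphs of type `(n, 2)`. -/
noncomputable def connectedSum {d : ℕ} (α : PoissonStructure d) (x : Fin d → ℝ) (n : ℕ) :
    MvPolynomial (PVar d) ℝ :=
  ∑ Γ : KGraph n 2 with Γ.IsConnected, Γ.weight • Γ.symbol α x

open Classical in
lemma sum_component_weight_symbol {d n : ℕ} (α : PoissonStructure d) (x : Fin d → ℝ)
    (S : Finset (Fin n)) (v : Fin n) :
    ∑ Γ : KGraph n 2 with Γ.component v = S, Γ.weight • Γ.symbol α x =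
      if v ∈ S then connectedSum α x S.card * graphSum α x (n - S.card) else 0 := by
  split_ifs with hv
  · have hc : Sᶜ.card = n - S.card := by rw [Finset.card_compl, Fintype.card_fin]
    -- The blocks are `S` and its complement, each numbered increasingly.
    rw [sum_component_eq _ (finSumEquivOfFinset rfl hc) S _ hv]
    · simp only [connectedSum, graphSum, weight_glue, symbol_glue, Finset.sum_mul_sum,
        smul_mul_smul_comm]
    · intro y
      have := Finset.range_orderEmbOfFin S rfl
      rw [← Finset.mem_coe, ← this]
      exact exists_congr fun j => eq_comm
  · refine Finset.sum_eq_zero fun Γ hΓ => absurd ?_ hv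
    rw [← (Finset.mem_filter.1 hΓ).2, mem_component]

/-- Double counting: a set of size `k` contains `k` marked vertices, and there are `n.choose k` such
sets. -/
lemma sum_sum_mem_card {M : Type*} [AddCommMonoid M] (n : ℕ) (g : ℕ → M) :
    ∑ v : Fin n, ∑ S : Finset (Fin n), (if v ∈ S then g S.card else 0) =
      ∑ k ∈ Finset.range (n + 1), n.choose k • (k • g k) := by
  rw [Finset.sum_comm, ← Finset.powerset_univ]
  have h := Finset.sum_powerset_apply_card (fun k => k • g k) (x := (Finset.univ : Finset (Fin n)))
  rw [Finset.card_univ, Fintype.card_fin] at h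
  rw [← h]
  refine Finset.sum_congr rfl fun S _ => ?_
  rw [← Finset.sum_filter, Finset.sum_const, Finset.filter_univ_mem]

/-- For each marked vertex, the graphs are partitioned by its component. Summing over the marked
vertex produces the factor `n`. -/
theorem nsmul_graphSum {d : ℕ} (α : PoissonStructure d) (x : Fin d → ℝ) (n : ℕ) :
    n • graphSum α x n = ∑ k ∈ Finset.range (n + 1),
      n.choose k • (k • (connectedSum α x k * graphSum α x (n - k))) := by
  have h : ∀ v : Fin n, ∑ S : Finset (Fin n),
      (if v ∈ S then connectedSum α x S.card * graphSum α x (n - S.card) else 0) =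
        graphSum α x n := fun v => by
    simp_rw [← sum_component_weight_symbol]
    exact Finset.sum_fiberwise Finset.univ (fun Γ : KGraph n 2 => Γ.component v) _
  rw [← sum_sum_mem_card n fun k => connectedSum α x k * graphSum α x (n - k),
    Finset.sum_congr rfl fun v _ => h v, Finset.sum_const, Finset.card_univ, Fintype.card_fin]

/-! ### The exponential of a power series -/

section Exp

open PowerSeries

variable {R : Type*} [CommRing R]

lemma coeff_X_mul_derivative (F : PowerSeries R) (n : ℕ) :
    coeff n (X * derivative R F) = n * coeff n F := by
  cases n with
  | zero => simp
  | succ n => rw [coeff_succ_X_mul, coeff_derivative]; push_cast; ring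

/-- The coefficients of `exp` are rational, so the base ring is immaterial; over `R` the chain rule
for `derivative` applies. -/
lemma subst_exp_real [Algebra ℝ R] [Algebra ℚ R] {E : PowerSeries R}
    (hE : constantCoeff E = 0) : subst E (exp ℝ) = subst E (exp R) := by
  ext n
  rw [coeff_subst' (HasSubst.of_constantCoeff_zero' hE),
    coeff_subst' (HasSubst.of_constantCoeff_zero' hE)]
  refine finsum_congr fun k => ?_
  rw [coeff_exp, coeff_exp, Algebra.smul_def, smul_eq_mul]
  congr 1
  exact RingHom.congr_fun (RingHom.ext_rat ((algebraMap ℝ R).comp (algebraMap ℚ ℝ)) _) _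

/-- The hypothesis `h` is `X A' = (X E') A` read coefficientwise. The exponential satisfies the same
equation, and the recursion has a unique solution because each `n > 0` is invertible. -/
theorem eq_subst_exp [Algebra ℝ R] [Algebra ℚ R] {E A : PowerSeries R}
    (hE : constantCoeff E = 0) (hA : coeff 0 A = 1)
    (h : ∀ n : ℕ, (n : R) * coeff n A = ∑ p ∈ Finset.HasAntidiagonal.antidiagonal n,
      (p.1 : R) * coeff p.1 E * coeff p.2 A) : A = subst E (exp ℝ) := by
  have hs := HasSubst.of_constantCoeff_zero' hE
  rw [subst_exp_real hE]
  have hB : ∀ n : ℕ, (n : R) * coeff n (subst E (exp R)) = ∑ p ∈ Finset.HasAntidiagonal.antidiagonal n,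
      (p.1 : R) * coeff p.1 E * coeff p.2 (subst E (exp R)) := fun n => by
    have hd := derivative_subst hs (f := exp R)
    rw [derivative_exp] at hd
    rw [← coeff_X_mul_derivative, hd, mul_comm (subst E (exp R)), ← mul_assoc, coeff_mul]
    simp only [coeff_X_mul_derivative]
  have hB0 : coeff 0 (subst E (exp R)) = 1 := by
    rw [coeff_subst' hs, finsum_eq_single _ 0]
    · simp
    · intro k hk
      simp [hE, hk]
  ext n
  induction n using Nat.strong_induction_on with
  | _ n ih =>
    rcases Nat.eq_zero_or_pos n with rfl | hn
    · rw [hA, hB0]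
    · have hu : IsUnit (n : R) := by
        have : (n : R) = algebraMap ℚ R n := by simp
        rw [this]
        exact (IsUnit.mk0 _ (by exact_mod_cast hn.ne')).map _
      refine hu.mul_left_cancel ?_
      rw [h, hB]
      refine Finset.sum_congr rfl fun p hp => ?_
      -- The only term containing `coeff n` of the unknown series has `p.1 = 0` and is killed by
      -- that factor.
      rcases Nat.eq_zero_or_pos p.1 with h0 | h0
      · simp [h0]
      · rw [ih p.2 (by have := Finset.HasAntidiagonal.mem_antidiagonal.1 hp; omega)]

end Exp

/-! ### The exponential formula for graph sums -/

lemma graphSum_zero {d : ℕ} (α : PoissonStructure d) (x : Fin d → ℝ) :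
    graphSum α x 0 = 1 := by
  have hu : Nonempty (Unique (KGraph 0 2)) :=
    ⟨⟨⟨⟨fun k => k.elim0, fun k => k.elim0, fun k => k.elim0⟩⟩,
      fun Γ => Subtype.ext (funext fun k => k.elim0)⟩⟩
  obtain ⟨_⟩ := hu
  rw [graphSum]
  simp_rw [weight_zero, symbol_zero]
  rw [Finset.sum_const, Finset.card_univ, Fintype.card_unique]
  simp

lemma connectedSum_zero {d : ℕ} (α : PoissonStructure d) (x : Fin d → ℝ) :
    connectedSum α x 0 = 0 := by
  classical
  refine Finset.sum_eq_zero fun Γ hΓ => ?_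
  obtain ⟨k⟩ := (Finset.mem_filter.1 hΓ).2.nonempty
  exact k.elim0

theorem mk_graphSum_eq_expSeries {d : ℕ} (α : PoissonStructure d) (x : Fin d → ℝ) :
    PowerSeries.mk (fun n => (1 / (n.factorial : ℝ)) • graphSum α x n) =
      expSeries (PowerSeries.mk fun n => (1 / (n.factorial : ℝ)) • connectedSum α x n) := by
  refine eq_subst_exp ?_ ?_ fun n => ?_
  · simp [← PowerSeries.coeff_zero_eq_constantCoeff_apply, connectedSum_zero]
  · simp [graphSum_zero]
  · have h := nsmul_graphSum α x n
    rw [Finset.Nat.sum_antidiagonal_eq_sum_range_succ_mk]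
    simp only [PowerSeries.coeff_mk]
    rw [mul_smul_comm, ← nsmul_eq_mul, h, Finset.smul_sum]
    refine Finset.sum_congr rfl fun k hk => ?_
    have hkn : k ≤ n := by simpa [Nat.lt_succ_iff] using hk
    rw [← nsmul_eq_mul, smul_comm k, smul_mul_smul_comm, ← Nat.cast_smul_eq_nsmul ℝ (n.choose k),
      smul_smul, smul_mul_assoc]
    congr 1
    -- `C(n,k)/n! = 1/(k! (n-k)!)` distributes the normalisation over the two factors.
    rw [Nat.cast_choose ℝ hkn]
    have := Nat.factorial_ne_zero n
    field_simp


namespace KGraph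

variable {n : ℕ}

/-! ### The number of loops -/

/-- The set of edges landing at aerial vertices. -/
def aerialEdges (Γ : KGraph n 2) : Finset (Fin n × Fin 2) :=
  Finset.univ.filter fun e => (Γ.target e).isLeft

/-- The unordered pair of endpoints of an edge landing at an aerial vertex. -/
def endpoints (Γ : KGraph n 2) (e : Fin n × Fin 2) : Sym2 (Fin n) :=
  s(e.1, (Γ.target e).elim id fun _ => e.1)

/-- Of the `2n` edges, those not landing on the ground are aerial; this exhibits `loops` as edges
minus vertices plus one. -/
lemma loops_eq (Γ : KGraph n 2) : Γ.loops = (Γ.aerialEdges.card : ℤ) - n + 1 := by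
  have h : Γ.aerialEdges.card + Γ.groundEdges = n * 2 := by
    have := Finset.card_filter_add_card_filter_not (s := (Finset.univ : Finset (Fin n × Fin 2)))
      fun e => (Γ.target e).isLeft = true
    simpa [aerialEdges, groundEdges] using this
  unfold loops
  omega

lemma mem_aerialEdges {Γ : KGraph n 2} {e : Fin n × Fin 2} :
    e ∈ Γ.aerialEdges ↔ ∃ l, Γ.target e = Sum.inl l := by
  simp [aerialEdges, Sum.isLeft_iff]

lemma edgeSet_eq_image (Γ : KGraph n 2) :
    Γ.aerialGraph.edgeSet = Γ.aerialEdges.image Γ.endpoints := by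
  ext p
  induction p with
  | _ k l =>
  rw [SimpleGraph.mem_edgeSet, Finset.mem_coe, Finset.mem_image]
  constructor
  · rintro ⟨_, ⟨i, hi⟩ | ⟨i, hi⟩⟩
    · exact ⟨(k, i), mem_aerialEdges.2 ⟨l, hi⟩, by simp [endpoints, target, hi]⟩
    · exact ⟨(l, i), mem_aerialEdges.2 ⟨k, hi⟩, by simp [endpoints, target, hi, Sym2.eq_swap]⟩
  · rintro ⟨⟨k', i⟩, he, hp⟩
    obtain ⟨l', hl'⟩ := mem_aerialEdges.1 he
    have hne : k' ≠ l' := fun h => Γ.2.1 k' i (h ▸ hl')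
    have hadj : Γ.aerialGraph.Adj k' l' := ⟨hne, Or.inl ⟨i, hl'⟩⟩
    rw [endpoints, hl', Sum.elim_inl, id, Sym2.eq_iff] at hp
    rcases hp with ⟨rfl, rfl⟩ | ⟨rfl, rfl⟩
    · exact hadj
    · exact hadj.symm

lemma card_edgeSet_eq (Γ : KGraph n 2) :
    Nat.card Γ.aerialGraph.edgeSet = (Γ.aerialEdges.image Γ.endpoints).card := by
  rw [edgeSet_eq_image, Nat.card_coe_set_eq, Set.ncard_coe_finset]

lemma card_edgeSet_le (Γ : KGraph n 2) :
    Nat.card Γ.aerialGraph.edgeSet ≤ Γ.aerialEdges.card := by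
  rw [card_edgeSet_eq]
  exact Finset.card_image_le

/-- Two distinct edges with the same unordered endpoints are parallel, which is excluded by `γ k 0 ≠
γ k 1`, or opposite. -/
lemma card_edgeSet_eq_iff (Γ : KGraph n 2) :
    Nat.card Γ.aerialGraph.edgeSet = Γ.aerialEdges.card ↔
      ∀ k l, ¬ ((∃ i, Γ.1 k i = Sum.inl l) ∧ ∃ i, Γ.1 l i = Sum.inl k) := by
  rw [card_edgeSet_eq, Finset.card_image_iff]
  constructor
  · rintro h k l ⟨⟨i, hi⟩, i', hi'⟩
    have heq := h (mem_aerialEdges.2 ⟨l, hi⟩ : (k, i) ∈ Γ.aerialEdges)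
      (mem_aerialEdges.2 ⟨k, hi'⟩ : (l, i') ∈ Γ.aerialEdges)
      (by simp [endpoints, target, hi, hi', Sym2.eq_swap])
    exact Γ.2.1 k i (by rw [hi, (Prod.mk.inj heq).1])
  · rintro h ⟨k, i⟩ he ⟨k', i'⟩ he' heq
    obtain ⟨l, hl⟩ := mem_aerialEdges.1 he
    obtain ⟨l', hl'⟩ := mem_aerialEdges.1 he'
    rw [endpoints, endpoints, hl, hl', Sum.elim_inl, Sum.elim_inl, id, id, Sym2.eq_iff] at heq
    rcases heq with ⟨h₁, rfl⟩ | ⟨h₁, rfl⟩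
    · obtain rfl : k = k' := h₁
      have h₂ := Γ.2.2 k
      have h₃ : Γ.1 k i = Γ.1 k i' := hl.trans hl'.symm
      fin_cases i <;> fin_cases i' <;> first | rfl | exact (h₂ h₃).elim | exact (h₂ h₃.symm).elim
    · obtain rfl : k = l' := h₁
      exact (h _ _ ⟨⟨i, hl⟩, ⟨i', hl'⟩⟩).elim

lemma IsConnected.loops_nonneg {Γ : KGraph n 2} (h : Γ.IsConnected) : 0 ≤ Γ.loops := by
  have h₁ := SimpleGraph.Connected.card_vert_le_card_edgeSet_add_one h
  have h₂ := Γ.card_edgeSet_le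
  rw [Nat.card_fin] at h₁
  rw [loops_eq]
  omega

lemma IsConnected.pos {Γ : KGraph n 2} (h : Γ.IsConnected) : 1 ≤ n := by
  obtain ⟨k⟩ := h.nonempty
  exact k.pos

/-- For connected graphs, `n - 1 ≤ |edgeSet| ≤ |aerialEdges|`. Zero loops means equal extremes, so
the first equality gives a tree and the second excludes opposite pairs. -/
theorem isTree_iff (Γ : KGraph n 2) : Γ.IsTree ↔ Γ.IsConnected ∧ Γ.loops = 0 := by
  rw [IsTree, SimpleGraph.isTree_iff_connected_and_card, ← card_edgeSet_eq_iff, Nat.card_fin,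
    loops_eq, IsConnected]
  constructor
  · rintro ⟨⟨h₁, h₂⟩, h₃⟩
    exact ⟨h₁, by omega⟩
  · rintro ⟨h₁, h₂⟩
    have h₃ := h₁.card_vert_le_card_edgeSet_add_one
    have h₄ := Γ.card_edgeSet_le
    rw [Nat.card_fin] at h₃
    exact ⟨⟨h₁, by omega⟩, by omega⟩

end KGraph

lemma mem_loopGraphs {n j : ℕ} {Γ : KGraph n 2} :
    (⟨n, Γ⟩ : Σ n : ℕ, KGraph n 2) ∈ loopGraphs j ↔ Γ.IsConnected ∧ Γ.loops = j :=
  ⟨fun h => h.2, fun h => ⟨h.1.pos, h⟩⟩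

/-! ### The coefficients of the exponent -/

lemma groundEdges_eq_degree {d n : ℕ} {α : PoissonStructure d} {x : Fin d → ℝ} {Γ : KGraph n 2}
    {β : PVar d →₀ ℕ} (h : MvPolynomial.coeff β (Γ.symbol α x) ≠ 0) :
    Γ.groundEdges = β.degree := by
  rw [← Γ.symbol_isHomogeneous α x h, Finsupp.degree_eq_weight_one]
  rfl

-- A nonzero coefficient in degree `k` forces `e_Γ = k`; with `j` loops this gives `n = j + k - 1 =
-- N`, so the infinite sum collapses to graphs of one size.
open Classical in
lemma homogeneousComponent_loopSeries {d : ℕ} (α : PoissonStructure d) (x : Fin d → ℝ)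
    {j k N : ℕ} (h : j + k = N + 1) :
    MvPolynomial.homogeneousComponent k (MvPowerSeries.truncTotal (k + 1) (loopSeries α x j)) =
      ∑ Γ : KGraph N 2 with Γ.IsConnected ∧ Γ.loops = (j : ℤ),
        (1 / (N.factorial : ℝ)) • (Γ.weight • Γ.symbol α x) := by
  ext β
  rw [MvPolynomial.coeff_homogeneousComponent, MvPolynomial.coeff_sum]
  simp only [MvPolynomial.coeff_smul, smul_eq_mul]
  split_ifs with hβ
  -- `truncTotal (k + 1)` keeps total degrees below `k + 1`, hence degree `k`.
  · rw [MvPowerSeries.coeff_truncTotal _ (by omega)]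
    let t : Finset (Σ n : ℕ, KGraph n 2) :=
      (Finset.univ.filter fun Γ : KGraph N 2 => Γ.IsConnected ∧ Γ.loops = (j : ℤ)).map
        ⟨Sigma.mk N, sigma_mk_injective⟩
    have ht : MvPowerSeries.coeff β (loopSeries α x j) = ∑ Γ ∈ t,
        Γ.2.weight / (Γ.1.factorial : ℝ) * MvPolynomial.coeff β (Γ.2.symbol α x) := by
      refine finsum_mem_eq_sum_of_inter_support_eq _ (Set.ext fun Γ => ?_)
      refine and_congr_left fun hΓ => ?_
      obtain ⟨n, Γ⟩ := Γ
      have hg := groundEdges_eq_degree (right_ne_zero_of_mul hΓ)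
      simp only [t, Finset.coe_map, Set.mem_image, Finset.mem_coe, Finset.mem_filter,
        Finset.mem_univ, true_and, Function.Embedding.coeFn_mk]
      constructor
      · intro hm
        obtain ⟨h₁, h₂⟩ := mem_loopGraphs.1 hm
        obtain rfl : n = N := by
          simp only [KGraph.loops] at h₂ hg
          omega
        exact ⟨Γ, ⟨h₁, h₂⟩, rfl⟩
      · rintro ⟨Γ', h', he⟩
        rw [← he]
        exact mem_loopGraphs.2 h'
    rw [ht, Finset.sum_map]
    refine Finset.sum_congr rfl fun Γ _ => ?_
    simp only [Function.Embedding.coeFn_mk]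
    ring
  · refine (Finset.sum_eq_zero fun Γ hΓ => ?_).symm
    by_contra hne
    have hg := groundEdges_eq_degree (right_ne_zero_of_mul (right_ne_zero_of_mul hne))
    have hl := (Finset.mem_filter.1 hΓ).2.2
    simp only [KGraph.loops] at hl
    omega

/-- No loops and no ground edges would require `n + 1 = 0`. This is the divisibility by `h`. -/
lemma homogeneousComponent_loopSeries_zero {d : ℕ} (α : PoissonStructure d) (x : Fin d → ℝ) :
    MvPolynomial.homogeneousComponent 0 (MvPowerSeries.truncTotal 1 (loopSeries α x 0)) = 0 := by
  ext β
  rw [MvPolynomial.coeff_homogeneousComponent, MvPolynomial.coeff_zero]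
  split_ifs with hβ
  · rw [MvPowerSeries.coeff_truncTotal _ (by omega)]
    refine finsum_mem_eq_zero_of_forall_eq_zero fun Γ hΓ => ?_
    by_contra hne
    have hg := groundEdges_eq_degree (right_ne_zero_of_mul hne)
    have hl := hΓ.2.2
    simp only [KGraph.loops] at hl
    omega
  · rfl

lemma coeff_zero_hScale_fullSeries {d : ℕ} (α : PoissonStructure d) (x : Fin d → ℝ) :
    PowerSeries.coeff 0 (hScale (fullSeries α x)) = 0 := by
  rw [hScale, PowerSeries.coeff_mk, Finset.HasAntidiagonal.antidiagonal_zero,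
    Finset.sum_singleton, fullSeries, PowerSeries.coeff_mk]
  exact homogeneousComponent_loopSeries_zero α x

lemma coeff_succ_hScale_fullSeries {d : ℕ} (α : PoissonStructure d) (x : Fin d → ℝ) (N : ℕ) :
    PowerSeries.coeff (N + 1) (hScale (fullSeries α x)) =
      (1 / (N.factorial : ℝ)) • connectedSum α x N := by
  classical
  rw [hScale, PowerSeries.coeff_mk, fullSeries]
  simp only [PowerSeries.coeff_mk]
  rw [Finset.sum_congr rfl fun p hp =>
    homogeneousComponent_loopSeries α x (Finset.HasAntidiagonal.mem_antidiagonal.1 hp)]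
  simp only [Finset.sum_filter]
  rw [Finset.sum_comm, connectedSum, Finset.sum_filter, Finset.smul_sum]
  refine Finset.sum_congr rfl fun Γ _ => ?_
  by_cases hΓ : Γ.IsConnected
  · obtain ⟨L, hL⟩ := Int.eq_ofNat_of_zero_le hΓ.loops_nonneg
    have hLN : L ≤ N + 1 := by
      simp only [KGraph.loops] at hL
      omega
    -- Each connected graph occurs once, at its own loop number `L`; `0 ≤ L ≤ N + 1` places that
    -- pair on the antidiagonal.
    rw [Finset.sum_eq_single (L, N + 1 - L)]
    · rw [if_pos ⟨hΓ, hL⟩, if_pos hΓ]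
    · intro p hp hne
      refine if_neg fun h => hne ?_
      have := Finset.HasAntidiagonal.mem_antidiagonal.1 hp
      have := h.2
      exact Prod.ext (by simp only; omega) (by simp only; omega)
    · intro h
      exact absurd (Finset.HasAntidiagonal.mem_antidiagonal.2 (by simp only; omega)) h
  · simp [hΓ]

lemma exponent_eq {d : ℕ} (α : PoissonStructure d) (x : Fin d → ℝ) :
    exponent α x = PowerSeries.mk fun n => (1 / (n.factorial : ℝ)) • connectedSum α x n := by
  ext1 n
  rw [exponent, divByH, PowerSeries.coeff_mk, PowerSeries.coeff_mk, coeff_succ_hScale_fullSeries]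

lemma coeff_hScale_C {d : ℕ} (F : MvPowerSeries (PVar d) ℝ) (N : ℕ) :
    PowerSeries.coeff N (hScale (PowerSeries.C F)) =
      MvPolynomial.homogeneousComponent N (MvPowerSeries.truncTotal (N + 1) F) := by
  rw [hScale, PowerSeries.coeff_mk, Finset.sum_eq_single (0, N)]
  · simp
  · rintro ⟨j, k⟩ hp hne
    have hj : j ≠ 0 := by
      rintro rfl
      exact hne (by simpa using hp)
    simp [PowerSeries.coeff_C, hj]
  · simp

lemma X_mul_divByH {R : Type*} [CommSemiring R] {F : PowerSeries R}
    (hF : PowerSeries.coeff 0 F = 0) : PowerSeries.X * divByH F = F := by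
  ext n
  cases n with
  | zero => simpa using hF.symm
  | succ n => rw [PowerSeries.coeff_succ_X_mul, divByH, PowerSeries.coeff_mk]

/-! ### The action of symbols on functions -/

section ApplySymbol

variable {d : ℕ} (f g : (Fin d → ℝ) → ℝ) (x : Fin d → ℝ)

/-- Summing over a common larger index set makes linearity in `Q` visible despite varying supports.
-/
lemma applySymbol_eq_sum {Q : MvPolynomial (PVar d) ℝ} {t : Finset (PVar d →₀ ℕ)}
    (ht : Q.support ⊆ t) : applySymbol Q f g x = ∑ β ∈ t, MvPolynomial.coeff β Q *
      (multiDeriv (fun i => β (0, i)) f x * multiDeriv (fun i => β (1, i)) g x) :=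
  Finset.sum_subset ht fun β _ hβ => by rw [MvPolynomial.notMem_support_iff.1 hβ, zero_mul]

lemma applySymbol_smul (c : ℝ) (Q : MvPolynomial (PVar d) ℝ) :
    applySymbol (c • Q) f g x = c * applySymbol Q f g x := by
  rw [applySymbol_eq_sum f g x (MvPolynomial.support_smul (a := c) (f := Q)), applySymbol,
    Finset.mul_sum]
  simp only [MvPolynomial.coeff_smul, smul_eq_mul, mul_assoc]

lemma applySymbol_sum {ι : Type*} (s : Finset ι) (Q : ι → MvPolynomial (PVar d) ℝ) :
    applySymbol (∑ i ∈ s, Q i) f g x = ∑ i ∈ s, applySymbol (Q i) f g x := by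
  classical
  rw [applySymbol_eq_sum f g x (MvPolynomial.support_sum (s := s) (f := Q)), Finset.sum_congr rfl
    fun i hi => applySymbol_eq_sum f g x
      (Finset.subset_biUnion_of_mem (fun i => (Q i).support) hi), Finset.sum_comm]
  simp only [MvPolynomial.coeff_sum, Finset.sum_mul]

lemma applySymbol_C_mul_prod (c : ℝ) (β : Fin 2 → Fin d → ℕ) :
    applySymbol (MvPolynomial.C c * ∏ a, ∏ i, MvPolynomial.X (a, i) ^ β a i) f g x =
      c * ∏ a, multiDeriv (β a) (![f, g] a) x := by
  have h : MvPolynomial.C c * ∏ a, ∏ i, MvPolynomial.X (a, i) ^ β a i =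
      MvPolynomial.monomial (Finsupp.equivFunOnFinite.symm fun q : PVar d => β q.1 q.2) c := by
    rw [MvPolynomial.monomial_eq, Finsupp.prod_fintype _ _ (by simp), Fintype.prod_prod_type]
    rfl
  rw [h, applySymbol_eq_sum f g x MvPolynomial.support_monomial_subset]
  simp

lemma applySymbol_symbol {n : ℕ} (α : PoissonStructure d) (Γ : KGraph n 2) :
    applySymbol (Γ.symbol α x) f g x = Γ.B α ![f, g] x := by
  rw [KGraph.symbol, applySymbol_sum]
  simp only [applySymbol_C_mul_prod, KGraph.B]

lemma coeff_star_eval (α : PoissonStructure d) (n : ℕ) :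
    PowerSeries.coeff n (star α f g) x =
      applySymbol ((1 / (n.factorial : ℝ)) • graphSum α x n) f g x := by
  rw [star, PowerSeries.coeff_mk]
  split_ifs with hn
  -- The empty graph has weight and symbol `1`, and `1` acts as the pointwise product `f g`.
  · subst hn
    have h : (1 : MvPolynomial (PVar d) ℝ) = MvPolynomial.C 1 *
        ∏ a : Fin 2, ∏ i : Fin d, MvPolynomial.X (a, i) ^ (0 : Fin 2 → Fin d → ℕ) a i := by simp
    have h0 : ∀ f : (Fin d → ℝ) → ℝ, multiDeriv 0 f = f := fun f => by
      unfold multiDeriv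
      induction List.finRange d with
      | nil => rfl
      | cons i L ih => rw [List.foldr_cons, ih]; rfl
    rw [graphSum_zero, Nat.factorial_zero, Nat.cast_one, div_one, one_smul, h,
      applySymbol_C_mul_prod]
    simp [h0]
  · rw [applySymbol_smul, graphSum, applySymbol_sum]
    simp [applySymbol_smul, applySymbol_symbol]

end ApplySymbol

/-! ### The semi-classical part and the main theorem -/

lemma generatingFunction_eq {d : ℕ} (α : PoissonStructure d) (x : Fin d → ℝ) :
    generatingFunction α x =
      PowerSeries.C (trivialGeneratingFunction x) + semiclassicalPart α x := by
  classical
  ext1 n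
  rw [generatingFunction, PowerSeries.coeff_mk, map_add, semiclassicalPart, divByH,
    PowerSeries.coeff_mk, coeff_hScale_C, homogeneousComponent_loopSeries α x (N := n) (by omega),
    PowerSeries.coeff_C, ← Finset.smul_sum]
  have h : (Finset.univ.filter fun Γ : KGraph n 2 => Γ.IsConnected ∧ Γ.loops = (0 : ℕ)) =
      Finset.univ.filter fun Γ : KGraph n 2 => Γ.IsTree :=
    Finset.filter_congr fun Γ _ => by rw [Γ.isTree_iff, Nat.cast_zero]
  rw [h]
  split_ifs with hn
  -- A tree has at least one aerial vertex, so `h^0` carries only the trivial generating function.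
  · subst hn
    rw [Finset.sum_eq_zero, smul_zero, add_zero]
    intro Γ hΓ
    have := (Γ.isTree_iff.1 (Finset.mem_filter.1 hΓ).2).1.pos
    omega
  · rw [zero_add]

end StarProduct

theorem mainTheorem7 {d : ℕ} (α : StarProduct.PoissonStructure d) (x : Fin d → ℝ) :
    -- `(1/h) D(h p_1, h p_2, x)` is a well-defined power series in `h` without constant term
    (PowerSeries.X * StarProduct.exponent α x =
        StarProduct.hScale (StarProduct.fullSeries α x) ∧
      PowerSeries.constantCoeff (StarProduct.exponent α x) = 0) ∧
    -- the exponential formula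
    (∀ f g : (Fin d → ℝ) → ℝ, ContDiff ℝ ∞ f → ContDiff ℝ ∞ g →
      PowerSeries.map (Pi.evalRingHom (fun _ : Fin d → ℝ => ℝ) x) (StarProduct.star α f g) =
        StarProduct.applySeries (StarProduct.expSeries (StarProduct.exponent α x)) f g x) ∧
    -- `D^0` is the tree part
    (∀ (n : ℕ) (Γ : StarProduct.KGraph n 2),
      (⟨n, Γ⟩ : Σ n : ℕ, StarProduct.KGraph n 2) ∈ StarProduct.loopGraphs 0 ↔ Γ.IsTree) ∧
    -- the semi-classical part `(1/h) D^0(h p_1, h p_2, x)` gives the generating function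
    PowerSeries.X * StarProduct.semiclassicalPart α x =
      StarProduct.hScale (PowerSeries.C (StarProduct.loopSeries α x 0)) ∧
    StarProduct.generatingFunction α x =
      PowerSeries.C (StarProduct.trivialGeneratingFunction x) +
        StarProduct.semiclassicalPart α x := by
  refine ⟨⟨StarProduct.X_mul_divByH (StarProduct.coeff_zero_hScale_fullSeries α x), ?_⟩,
    fun f g _ _ => ?_, fun n Γ => ?_, StarProduct.X_mul_divByH ?_,
    StarProduct.generatingFunction_eq α x⟩
  · rw [StarProduct.exponent_eq, ← PowerSeries.coeff_zero_eq_constantCoeff_apply,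
      PowerSeries.coeff_mk, StarProduct.connectedSum_zero, smul_zero]
  · ext n
    rw [PowerSeries.coeff_map, StarProduct.applySeries, PowerSeries.coeff_mk,
      StarProduct.exponent_eq, ← StarProduct.mk_graphSum_eq_expSeries, PowerSeries.coeff_mk]
    exact StarProduct.coeff_star_eval f g x α n
  · rw [StarProduct.mem_loopGraphs, Γ.isTree_iff, Nat.cast_zero]
  · rw [StarProduct.coeff_hScale_C]
    exact StarProduct.homogeneousComponent_loopSeries_zero α x
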